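/- **Theorem.** Let $d\in\mathbb N$, $\lambda>0$, let $t$ be a fixed time with schedule values $\alpha_t,\beta_t\in\mathbb R$, $\alpha_t\neq 0$, and let $x_t\in\mathbb R^d$. Let $p_0$ be a continuously differentiable probability density on $\mathbb R^d$, let $Q:\mathbb R^d\to\mathbb R$ be continuously differentiable with $\int \exp(Q/\lambda)<\infty$, and let $p_1=\exp(Q/\lambda)/\int\exp(Q/\lambda)$ be the Boltzmann density. Put $x_1(x_0)=\frac1{\alpha_t}x_t-\frac{\beta_t}{\alpha_t}x_0$, assume that $x_0\mapsto p_0(x_0)\,p_1(x_1(x_0))$ is integrable, and let $q(\cdot\mid x_t)$ be the noise posterior, i.e. the probability density on $\mathbb R^d$ proportional to it. Below, $\mathbb E$ is the expectation over $X_0\sim q(\cdot\mid x_t)$, and $\mu_{0\mid t}(x_t)=\mathbb E[X_0]$. For a $C^1$ density $p$ and a $C^1$ map $\Phi=[\phi_1,\dots,\phi_m]:\mathbb R^d\to\mathbb R^{d\times m}$ let $\mathcal T_{p,m}\Phi$ be the generalized Langevin Stein operator, $(\mathcal T_{p,m}\Phi)_j=\nabla\cdot\phi_j+\phi_j\cdot\nabla\log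 p$. For $\Lambda\in\mathbb R^d$ let $g_\Lambda=\mathcal T_{q(\cdot\mid x_t),d}\,\Phi$ be the control variate of the constant diagonal test function $\Phi\equiv\operatorname{diag}(\Lambda)$. Then: 1. For every $\Lambda\in\mathbb R^d$ and every $x_0$ with $p_0(x_0)>0$, $$g_\Lambda(x_0)=\operatorname{diag}(\Lambda)\nabla\log p_0(x_0)-\frac1\lambda\frac{\beta_t}{\alpha_t}\operatorname{diag}(\Lambda)\,\nabla Q(x_1(x_0)).$$ 2. For every $\Lambda\in\mathbb R^d$ such that $\mathbb E\|X_0\|<\infty$ and $\mathbb E\|g_\Lambda(X_0)\|<\infty$, the following integrand is integrable and $$\mu_{0\mid t}(x_t)=\mathbb E\Big[X_0+\operatorname{diag}(\Lambda)\nabla\log p_0(X_0)-\frac1\lambda\frac{\beta_t}{\alpha_t}\operatorname{diag}(\Lambda)\nabla Q(x_1(X_0))\Big].$$ 3. If $p_0$ is the density of $\mathcal N(0,I_d)$, then $\mathbb E\|X_0\|<\infty$, and, if $\mathbb E\|g_{(1,\dots,1)}(X_0)\|<\infty$, then $\nabla Q(x_1(X_0))$ multiplied by $\frac1\lambda\frac{\beta_t}{\alpha_t}$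 is integrable and $$\mathbb E[X_0]=\mathbb E\Big[-\frac1\lambda\frac{\beta_t}{\alpha_t}\nabla Q(x_1(X_0))\Big].$$ Moreover, for every $\eta\in\mathbb R$ such that the isotropic control variate $g_{(\eta,\dots,\eta)}$ satisfies $\mathbb E\|g_{(\eta,\dots,\eta)}(X_0)\|<\infty$, $$\mu_{0\mid t}(x_t)=(1-\eta)\,\mathbb E[X_0]+\eta\,\mathbb E\Big[-\frac1\lambda\frac{\beta_t}{\alpha_t}\nabla Q(x_1(X_0))\Big]$$ (for $\eta=0$ the second term is read as $0$); $\eta=0$ is the noise-expectation and $\eta=1$ the gradient-expectation representation. -/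

import Mathlib

open MeasureTheory

noncomputable section

namespace ReverseFlow

/-- `p` is a continuously differentiable probability density on `ℝ^d`
(with respect to Lebesgue measure). -/
structure IsC1Density {d : ℕ} (p : EuclideanSpace ℝ (Fin d) → ℝ) : Prop where
  contDiff : ContDiff ℝ 1 p
  nonneg : ∀ x, 0 ≤ p x
  integrable : Integrable p volume
  integral_eq_one : ∫ x, p x = 1

/-- The density of the standard Gaussian `N(0, I_d)`. -/
def gaussianDensity (d : ℕ) (x : EuclideanSpace ℝ (Fin d)) : ℝ :=
  (2 * Real.pi) ^ (-(d : ℝ) / 2) * Real.exp (-‖x‖ ^ 2 / 2)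

/-- The Boltzmann density `p₁(x) = exp (Q x / lam) / ∫ exp (Q / lam)`. -/
def boltzmannDensity {d : ℕ} (lam : ℝ) (Q : EuclideanSpace ℝ (Fin d) → ℝ)
    (x : EuclideanSpace ℝ (Fin d)) : ℝ :=
  Real.exp (1 / lam * Q x) / ∫ y, Real.exp (1 / lam * Q y)

/-- The endpoint `x₁ = x_t / a - (b / a) x₀` determined by `x_t = a x₁ + b x₀`. -/
def impliedTarget {d : ℕ} (a b : ℝ) (xt x₀ : EuclideanSpace ℝ (Fin d)) :
    EuclideanSpace ℝ (Fin d) :=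
  (1 / a) • xt - (b / a) • x₀

/-- The unnormalized posterior density `p₀(x₀) p₁(x_t / a - (b / a) x₀)` of the noise. -/
def posteriorWeight {d : ℕ} (p₀ p₁ : EuclideanSpace ℝ (Fin d) → ℝ) (a b : ℝ)
    (xt x₀ : EuclideanSpace ℝ (Fin d)) : ℝ :=
  p₀ x₀ * p₁ (impliedTarget a b xt x₀)

/-- The noise posterior density `q(x₀ ∣ x_t)`. -/
def posteriorDensity {d : ℕ} (p₀ p₁ : EuclideanSpace ℝ (Fin d) → ℝ) (a b : ℝ)
    (xt x₀ : EuclideanSpace ℝ (Fin d)) : ℝ :=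
  posteriorWeight p₀ p₁ a b xt x₀ / ∫ y, posteriorWeight p₀ p₁ a b xt y

/-- The noise posterior distribution, the law with density `q(· ∣ x_t)`. -/
def posterior {d : ℕ} (p₀ p₁ : EuclideanSpace ℝ (Fin d) → ℝ) (a b : ℝ)
    (xt : EuclideanSpace ℝ (Fin d)) : Measure (EuclideanSpace ℝ (Fin d)) :=
  volume.withDensity fun x₀ => ENNReal.ofReal (posteriorDensity p₀ p₁ a b xt x₀)

/-- The score `∇ log p`. -/
def score {d : ℕ} (p : EuclideanSpace ℝ (Fin d) → ℝ) (x : EuclideanSpace ℝ (Fin d)) :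
    EuclideanSpace ℝ (Fin d) :=
  gradient (fun y => Real.log (p y)) x

/-- The divergence `∑ i, ∂ φ_i / ∂ x_i`. -/
def divergence {d : ℕ} (φ : EuclideanSpace ℝ (Fin d) → EuclideanSpace ℝ (Fin d))
    (x : EuclideanSpace ℝ (Fin d)) : ℝ :=
  ∑ i, fderiv ℝ (fun y => φ y i) x (EuclideanSpace.single i 1)

/-- The Langevin Stein operator `(T_p φ)(x) = ∇ · φ (x) + φ(x) · ∇ log p(x)`. -/
def steinOp {d : ℕ} (p : EuclideanSpace ℝ (Fin d) → ℝ)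
    (φ : EuclideanSpace ℝ (Fin d) → EuclideanSpace ℝ (Fin d))
    (x : EuclideanSpace ℝ (Fin d)) : ℝ :=
  divergence φ x + inner ℝ (φ x) (score p x)

/-- The generalized Langevin Stein operator: `T_p` applied to every column of `Φ`. -/
def genSteinOp {d m : ℕ} (p : EuclideanSpace ℝ (Fin d) → ℝ)
    (Φ : EuclideanSpace ℝ (Fin d) → Matrix (Fin d) (Fin m) ℝ)
    (x : EuclideanSpace ℝ (Fin d)) : EuclideanSpace ℝ (Fin m) :=
  WithLp.toLp 2 fun j => steinOp p (fun y => WithLp.toLp 2 fun i => Φ y i j) x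

/-- `diag(Λ) v`. -/
def diagMul {d : ℕ} (Λ : Fin d → ℝ) (v : EuclideanSpace ℝ (Fin d)) :
    EuclideanSpace ℝ (Fin d) :=
  WithLp.toLp 2 (Matrix.mulVec (Matrix.diagonal Λ) (WithLp.ofLp v))

/-- The control variate `g_Φ(·, x_t)` given by the constant diagonal test function
`Φ = diag(Λ)` under the noise posterior density. -/
def controlVariate {d : ℕ} (p₀ p₁ : EuclideanSpace ℝ (Fin d) → ℝ) (a b : ℝ)
    (xt : EuclideanSpace ℝ (Fin d)) (Λ : Fin d → ℝ) (x₀ : EuclideanSpace ℝ (Fin d)) :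
    EuclideanSpace ℝ (Fin d) :=
  genSteinOp (posteriorDensity p₀ p₁ a b xt) (fun _ => Matrix.diagonal Λ) x₀

/-- The posterior mean `E[X₀]` for `X₀ ∼ q(· ∣ x_t)`. -/
def posteriorMean {d : ℕ} (p₀ p₁ : EuclideanSpace ℝ (Fin d) → ℝ) (a b : ℝ)
    (xt : EuclideanSpace ℝ (Fin d)) : EuclideanSpace ℝ (Fin d) :=
  ∫ x₀, x₀ ∂(posterior p₀ p₁ a b xt)

/-- The gradient term `-(1/lam) (b/a) ∇Q (x_t / a - (b / a) x₀)`. -/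
def gradTerm {d : ℕ} (lam : ℝ) (Q : EuclideanSpace ℝ (Fin d) → ℝ) (a b : ℝ)
    (xt x₀ : EuclideanSpace ℝ (Fin d)) : EuclideanSpace ℝ (Fin d) :=
  -((1 / lam * (b / a)) • gradient Q (impliedTarget a b xt x₀))

end ReverseFlow

end

namespace ReverseFlow

open MeasureTheory Filter Topology

variable {d : ℕ}

/-! A constant test function has zero divergence, so its control variate is `diag(Λ) ∇ log q`. Where
`p₀ > 0`, `log q` is `log p₀` plus `Q / lam` along the affine map `impliedTarget`, plus a constant;
the chain rule gives the formula (`score_posteriorDensity`).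

The mean is unchanged because the control variate has expectation zero
(`integral_genSteinOp_diagonal`): `q ∇ log q = ∇q`, and an integrable partial derivative of an
integrable `C¹` function integrates to zero over the whole space, so no decay at infinity need be
assumed. Points with `p₀ = 0` are null for the posterior.

For a Gaussian source the score is `-x`, so with `Λ = 1` the term `X₀` cancels and only the gradient
term remains. Both representations then have the same value, hence so does every affine combination
of them. -/

/-- The Stein operator of the constant test function `diag(Λ)` is `diag(Λ) ∇ log p`. -/
lemma genSteinOp_diagonal (p : EuclideanSpace ℝ (Fin d) → ℝ) (Λ : Fin d → ℝ)
    (x : EuclideanSpace ℝ (Fin d)) :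
    genSteinOp p (fun _ => Matrix.diagonal Λ) x = diagMul Λ (score p x) := by
  ext j
  simp [genSteinOp, steinOp, divergence, diagMul, PiLp.inner_apply, Matrix.diagonal_apply,
    Matrix.mulVec_diagonal, mul_comm]

/-! ### Coordinates of diagonal scaling and of gradients -/

lemma diagMul_apply (Λ : Fin d → ℝ) (v : EuclideanSpace ℝ (Fin d)) (i : Fin d) :
    diagMul Λ v i = Λ i * v i := by
  simp [diagMul, Matrix.mulVec_diagonal]

lemma diagMul_const (c : ℝ) (v : EuclideanSpace ℝ (Fin d)) :
    diagMul (fun _ => c) v = c • v := by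
  ext i
  simp [diagMul_apply]

lemma diagMul_sub (Λ : Fin d → ℝ) (v w : EuclideanSpace ℝ (Fin d)) :
    diagMul Λ (v - w) = diagMul Λ v - diagMul Λ w := by
  ext i
  simp [diagMul_apply, mul_sub]

lemma diagMul_smul (Λ : Fin d → ℝ) (c : ℝ) (v : EuclideanSpace ℝ (Fin d)) :
    diagMul Λ (c • v) = c • diagMul Λ v := by
  ext i
  simp [diagMul_apply, mul_left_comm]

lemma gradient_apply_coord (f : EuclideanSpace ℝ (Fin d) → ℝ) (x : EuclideanSpace ℝ (Fin d))
    (i : Fin d) : gradient f x i = fderiv ℝ f x (EuclideanSpace.single i 1) := by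
  rw [← inner_gradient_left, EuclideanSpace.inner_single_right]
  simp

/-! ### Stein's identity -/

/-- `p ∇ log p = ∇ p` for a nonnegative differentiable `p`, also at the zeros of `p`. -/
lemma mul_score_apply {p : EuclideanSpace ℝ (Fin d) → ℝ} (hp : Differentiable ℝ p)
    (hp0 : ∀ x, 0 ≤ p x) (x : EuclideanSpace ℝ (Fin d)) (i : Fin d) :
    p x * score p x i = fderiv ℝ p x (EuclideanSpace.single i 1) := by
  by_cases hx : p x = 0
  -- A zero of a nonnegative function is a minimum, so the derivative vanishes there and the value
  -- of the score is irrelevant.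
  · have hmin : IsLocalMin p x := Eventually.of_forall fun y => hx ▸ hp0 y
    simp [hx, hmin.fderiv_eq_zero]
  · rw [score, gradient_apply_coord, ((hp x).hasFDerivAt.log hx).fderiv]
    simp [hx]

/-- The integral of a directional derivative vanishes. -/
lemma integral_fderiv_apply_eq_zero {p : EuclideanSpace ℝ (Fin d) → ℝ} (hp : Differentiable ℝ p)
    (hpi : Integrable p volume) (v : EuclideanSpace ℝ (Fin d))
    (hv : Integrable (fun x => fderiv ℝ p x v) volume) : ∫ x, fderiv ℝ p x v = 0 := by
  -- Integration by parts against the constant 1, whose derivative is zero.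
  have h := integral_mul_fderiv_eq_neg_fderiv_mul_of_integrable (μ := volume) (f := fun _ => (1 : ℝ))
    (g := p) (v := v) (by simp) (by simpa using hv) (by simpa using hpi)
    (fun x _ => by fun_prop) (fun x _ => hp x)
  simpa using h

lemma integrable_withDensity_ofReal_iff {q : EuclideanSpace ℝ (Fin d) → ℝ} (hq : Continuous q)
    (hq0 : ∀ x, 0 ≤ q x) {g : EuclideanSpace ℝ (Fin d) → EuclideanSpace ℝ (Fin d)} :
    Integrable g (volume.withDensity fun x => ENNReal.ofReal (q x)) ↔
      Integrable (fun x => q x • g x) volume := by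
  rw [integrable_withDensity_iff_integrable_smul' (by fun_prop) (by simp)]
  simp [ENNReal.toReal_ofReal (hq0 _)]

lemma integral_withDensity_ofReal {q : EuclideanSpace ℝ (Fin d) → ℝ} (hq : Continuous q)
    (hq0 : ∀ x, 0 ≤ q x) (g : EuclideanSpace ℝ (Fin d) → EuclideanSpace ℝ (Fin d)) :
    ∫ x, g x ∂(volume.withDensity fun x => ENNReal.ofReal (q x)) = ∫ x, q x • g x := by
  rw [integral_withDensity_eq_integral_toReal_smul (by fun_prop) (by simp)]
  simp [ENNReal.toReal_ofReal (hq0 _)]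

/-- Stein's identity for constant diagonal test functions: no boundary condition is needed
beyond integrability. -/
lemma integral_genSteinOp_diagonal {q : EuclideanSpace ℝ (Fin d) → ℝ} (hq : ContDiff ℝ 1 q)
    (hq0 : ∀ x, 0 ≤ q x) (hqi : Integrable q volume) (Λ : Fin d → ℝ)
    (hg : Integrable (genSteinOp q fun _ => Matrix.diagonal Λ)
      (volume.withDensity fun x => ENNReal.ofReal (q x))) :
    ∫ x, genSteinOp q (fun _ => Matrix.diagonal Λ) x
      ∂(volume.withDensity fun x => ENNReal.ofReal (q x)) = 0 := by
  have hd : Differentiable ℝ q := hq.differentiable one_ne_zero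
  rw [integral_withDensity_ofReal hq.continuous hq0]
  rw [integrable_withDensity_ofReal_iff hq.continuous hq0] at hg
  have hcoord : ∀ x i, (q x • genSteinOp q (fun _ => Matrix.diagonal Λ) x) i =
      Λ i * fderiv ℝ q x (EuclideanSpace.single i 1) := fun x i => by
    rw [genSteinOp_diagonal, PiLp.smul_apply, diagMul_apply, ← mul_score_apply hd hq0, smul_eq_mul]
    ring
  ext i
  have hproj := (EuclideanSpace.proj (𝕜 := ℝ) i).integral_comp_comm hg
  have hint := (EuclideanSpace.proj (𝕜 := ℝ) i).integrable_comp hg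
  simp only [PiLp.proj_apply, hcoord] at hproj hint
  rw [← hproj, integral_const_mul, PiLp.zero_apply]
  -- Only `Λ i * ∂ᵢq` is known to be integrable; this passes to `∂ᵢq` when `Λ i ≠ 0`, and otherwise
  -- the coordinate is zero anyway.
  rcases eq_or_ne (Λ i) 0 with h0 | h0
  · simp [h0]
  · rw [integral_fderiv_apply_eq_zero hd hqi _ ((integrable_const_mul_iff h0.isUnit _).1 hint),
      mul_zero]

/-! ### Regularity and positivity of the Boltzmann and posterior densities -/

section Boltzmann

variable {lam : ℝ} {Q : EuclideanSpace ℝ (Fin d) → ℝ}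

lemma boltzmannDensity_pos (hZ : Integrable (fun x => Real.exp (1 / lam * Q x)) volume)
    (x : EuclideanSpace ℝ (Fin d)) : 0 < boltzmannDensity lam Q x :=
  div_pos (Real.exp_pos _) (integral_exp_pos hZ)

lemma contDiff_boltzmannDensity (hQ : ContDiff ℝ 1 Q) :
    ContDiff ℝ 1 (boltzmannDensity lam Q) :=
  (contDiff_const.mul hQ).exp.div_const _

end Boltzmann

lemma contDiff_impliedTarget (a b : ℝ) (xt : EuclideanSpace ℝ (Fin d)) :
    ContDiff ℝ 1 (impliedTarget a b xt) := by
  unfold impliedTarget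
  fun_prop

section Posterior

variable {p₀ p₁ : EuclideanSpace ℝ (Fin d) → ℝ} {a b : ℝ} {xt : EuclideanSpace ℝ (Fin d)}

lemma contDiff_posteriorWeight (h₀ : ContDiff ℝ 1 p₀) (h₁ : ContDiff ℝ 1 p₁) :
    ContDiff ℝ 1 (posteriorWeight p₀ p₁ a b xt) :=
  h₀.mul (h₁.comp (contDiff_impliedTarget a b xt))

lemma contDiff_posteriorDensity (h₀ : ContDiff ℝ 1 p₀) (h₁ : ContDiff ℝ 1 p₁) :
    ContDiff ℝ 1 (posteriorDensity p₀ p₁ a b xt) :=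
  (contDiff_posteriorWeight h₀ h₁).div_const _

lemma IsC1Density.exists_ne_zero (h₀ : IsC1Density p₀) : ∃ x, p₀ x ≠ 0 := by
  by_contra! h
  simpa [h] using h₀.integral_eq_one

/-- `p₀` has mass one, so it is nonzero somewhere; as `p₁` never vanishes, the continuous
nonnegative weight is nonzero there too. -/
lemma integral_posteriorWeight_pos (h₀ : IsC1Density p₀) (h₁ : ContDiff ℝ 1 p₁)
    (hpos : ∀ x, 0 < p₁ x) (hpost : Integrable (posteriorWeight p₀ p₁ a b xt) volume) :
    0 < ∫ x, posteriorWeight p₀ p₁ a b xt x := by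
  obtain ⟨x, hx⟩ := h₀.exists_ne_zero
  exact integral_pos_of_integrable_nonneg_nonzero
    (contDiff_posteriorWeight h₀.contDiff h₁).continuous hpost
    (fun y => mul_nonneg (h₀.nonneg y) (hpos _).le) (x := x) (mul_ne_zero hx (hpos _).ne')

lemma posteriorDensity_nonneg (h₀ : ∀ x, 0 ≤ p₀ x) (h₁ : ∀ x, 0 ≤ p₁ x)
    (x : EuclideanSpace ℝ (Fin d)) : 0 ≤ posteriorDensity p₀ p₁ a b xt x :=
  div_nonneg (mul_nonneg (h₀ x) (h₁ _))
    (integral_nonneg fun y => mul_nonneg (h₀ y) (h₁ _))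

/-- Under the posterior, the source density is almost surely positive. -/
lemma ae_posterior_pos (h₀ : IsC1Density p₀) (h₁ : ContDiff ℝ 1 p₁) :
    ∀ᵐ x ∂(posterior p₀ p₁ a b xt), 0 < p₀ x := by
  have hc := (contDiff_posteriorDensity (a := a) (b := b) (xt := xt) h₀.contDiff h₁).continuous
  rw [posterior, ae_withDensity_iff (by fun_prop)]
  refine Eventually.of_forall fun x hx => (h₀.nonneg x).lt_of_ne fun h => hx ?_
  simp [posteriorDensity, posteriorWeight, ← h]

end Posterior

/-! ### The score of the posterior -/

lemma hasFDerivAt_impliedTarget (a b : ℝ) (xt x : EuclideanSpace ℝ (Fin d)) :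
    HasFDerivAt (impliedTarget a b xt)
      (-((b / a) • ContinuousLinearMap.id ℝ (EuclideanSpace ℝ (Fin d)))) x :=
  ((hasFDerivAt_id x).const_smul (b / a)).const_sub _

/-- The score of the posterior is the score of the source plus the gradient term. -/
lemma score_posteriorDensity {p₀ Q : EuclideanSpace ℝ (Fin d) → ℝ} {lam a b : ℝ}
    {xt x : EuclideanSpace ℝ (Fin d)} (h₀ : Differentiable ℝ p₀) (hQ : Differentiable ℝ Q)
    (hZ : Integrable (fun x => Real.exp (1 / lam * Q x)) volume) (hx : 0 < p₀ x)
    (hW : 0 < ∫ y, posteriorWeight p₀ (boltzmannDensity lam Q) a b xt y) :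
    score (posteriorDensity p₀ (boltzmannDensity lam Q) a b xt) x =
      score p₀ x - (1 / lam * (b / a)) • gradient Q (impliedTarget a b xt x) := by
  set W := ∫ y, posteriorWeight p₀ (boltzmannDensity lam Q) a b xt y with hWdef
  -- Splitting the logarithm needs `p₀ > 0`, which by continuity holds near `x`; a gradient sees no
  -- more than that.
  have hlog : (fun y => Real.log (posteriorDensity p₀ (boltzmannDensity lam Q) a b xt y)) =ᶠ[𝓝 x]
      fun y => Real.log (p₀ y) + 1 / lam * Q (impliedTarget a b xt y)
        - (Real.log (∫ z, Real.exp (1 / lam * Q z)) + Real.log W) := by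
    filter_upwards [h₀.continuous.continuousAt.eventually (lt_mem_nhds hx)] with y hy
    have hI := integral_exp_pos hZ
    have hb := boltzmannDensity_pos hZ (impliedTarget a b xt y)
    rw [posteriorDensity, ← hWdef, posteriorWeight,
      Real.log_div (mul_pos hy hb).ne' hW.ne', Real.log_mul hy.ne' hb.ne', boltzmannDensity,
      Real.log_div (Real.exp_pos _).ne' hI.ne', Real.log_exp]
    ring
  have hp := (h₀ x).hasFDerivAt.log hx.ne'
  have hq := ((hQ (impliedTarget a b xt x)).hasFDerivAt.comp x
    (hasFDerivAt_impliedTarget a b xt x)).const_mul (1 / lam)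
  have hsum := (hp.add hq).sub_const
    (Real.log (∫ z, Real.exp (1 / lam * Q z)) + Real.log W)
  ext i
  rw [score, hlog.gradient_eq, score, PiLp.sub_apply, PiLp.smul_apply, gradient_apply_coord,
    gradient_apply_coord, gradient_apply_coord, hp.fderiv]
  erw [hsum.fderiv]
  simp
  ring

/-! ### Gaussian source: score and first moment -/

section Gaussian

lemma score_gaussianDensity (x : EuclideanSpace ℝ (Fin d)) :
    score (gaussianDensity d) x = -x := by
  have hlog : (fun y : EuclideanSpace ℝ (Fin d) => Real.log (gaussianDensity d y)) =
      fun y => Real.log ((2 * Real.pi) ^ (-(d : ℝ) / 2)) + -‖y‖ ^ 2 / 2 := by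
    funext y
    have hc : 0 < (2 * Real.pi) ^ (-(d : ℝ) / 2) := by positivity
    rw [gaussianDensity, Real.log_mul hc.ne' (Real.exp_pos _).ne', Real.log_exp]
  have hn := (((hasStrictFDerivAt_norm_sq x).hasFDerivAt.neg.mul_const (2⁻¹ : ℝ))).const_add
    (Real.log ((2 * Real.pi) ^ (-(d : ℝ) / 2)))
  ext i
  rw [score, hlog, gradient_apply_coord]
  simp only [div_eq_mul_inv] at hn ⊢
  erw [hn.fderiv]
  simp [PiLp.inner_apply]

lemma mul_exp_neg_sq_le (r : ℝ) : r * Real.exp (-r ^ 2 / 4) ≤ 1 := by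
  have h1 : r ≤ Real.exp (r ^ 2 / 4) := by
    -- `(r / 2 - 1) ^ 2 ≥ 0` says `r ≤ 1 + r ^ 2 / 4`.
    nlinarith [Real.add_one_le_exp (r ^ 2 / 4), sq_nonneg (r / 2 - 1)]
  calc r * Real.exp (-r ^ 2 / 4) ≤ Real.exp (r ^ 2 / 4) * Real.exp (-r ^ 2 / 4) := by gcongr
    _ = 1 := by rw [← Real.exp_add]; ring_nf; simp

lemma integrable_exp_neg_sq_div_four :
    Integrable (fun x : EuclideanSpace ℝ (Fin d) => Real.exp (-‖x‖ ^ 2 / 4)) volume := by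
  have h := (GaussianFourier.integrable_cexp_neg_mul_sq_norm_add (V := EuclideanSpace ℝ (Fin d))
    (b := (1 / 4 : ℂ)) (by norm_num) 0 0).norm
  refine h.congr (Eventually.of_forall fun x => ?_)
  have : (-(1 / 4 : ℂ) * (‖x‖ : ℂ) ^ 2 + 0 * (inner ℝ 0 x : ℝ)) = ((-‖x‖ ^ 2 / 4 : ℝ) : ℂ) := by
    push_cast
    ring
  simp only [this, ← Complex.ofReal_exp, Complex.norm_real, Real.norm_eq_abs, Real.abs_exp]

/-- Half of the Gaussian exponent absorbs the factor `‖x‖`; the other half keeps the bound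
integrable, as the case `b = 0` requires. -/
lemma gaussianDensity_mul_norm_le (x : EuclideanSpace ℝ (Fin d)) :
    gaussianDensity d x * ‖x‖ ≤
      (2 * Real.pi) ^ (-(d : ℝ) / 2) * Real.exp (-‖x‖ ^ 2 / 4) := by
  have hsplit : Real.exp (-‖x‖ ^ 2 / 2) = Real.exp (-‖x‖ ^ 2 / 4) * Real.exp (-‖x‖ ^ 2 / 4) := by
    rw [← Real.exp_add]
    ring_nf
  rw [gaussianDensity, hsplit, mul_assoc, mul_assoc]
  gcongr
  exact mul_le_of_le_one_right (Real.exp_pos _).le (by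
    rw [mul_comm]; exact mul_exp_neg_sq_le _)

/-- With a Gaussian source and an integrable target, `‖x‖` is integrable against the posterior
weight: for `b = 0` by the Gaussian tail, otherwise because `‖x‖ p₀(x)` is bounded. -/
lemma integrable_posteriorWeight_smul_id {p₁ : EuclideanSpace ℝ (Fin d) → ℝ} {a b : ℝ}
    {xt : EuclideanSpace ℝ (Fin d)} (ha : a ≠ 0) (h₁ : Integrable p₁ volume)
    (hc : Continuous p₁) (hpos : ∀ x, 0 ≤ p₁ x) :
    Integrable (fun x => posteriorWeight (gaussianDensity d) p₁ a b xt x • x) volume := by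
  have hcg : Continuous (gaussianDensity d) := by
    unfold gaussianDensity
    fun_prop
  have hct := (contDiff_impliedTarget a b xt).continuous
  have hmeas : AEStronglyMeasurable
      (fun x => posteriorWeight (gaussianDensity d) p₁ a b xt x • x) volume := by
    unfold posteriorWeight
    exact Continuous.aestronglyMeasurable (by fun_prop)
  have hg0 : ∀ x, 0 ≤ gaussianDensity d x := fun x => by
    unfold gaussianDensity
    positivity
  have hnorm : ∀ x, ‖posteriorWeight (gaussianDensity d) p₁ a b xt x • x‖ ≤
      (2 * Real.pi) ^ (-(d : ℝ) / 2) * Real.exp (-‖x‖ ^ 2 / 4) * p₁ (impliedTarget a b xt x) :=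
    fun x => by
      rw [norm_smul, posteriorWeight, Real.norm_of_nonneg (mul_nonneg (hg0 x) (hpos _)),
        mul_right_comm]
      exact mul_le_mul_of_nonneg_right (gaussianDensity_mul_norm_le x) (hpos _)
  rcases eq_or_ne b 0 with rfl | hb
  · refine ((integrable_exp_neg_sq_div_four.const_mul ((2 * Real.pi) ^ (-(d : ℝ) / 2))).mul_const
      (p₁ ((1 / a) • xt))).mono' hmeas (Eventually.of_forall fun x => ?_)
    simpa [impliedTarget] using hnorm x
  -- For `b ≠ 0` the implied target is an invertible affine function of `x`, so integrability of
  -- `p₁` is preserved.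
  · have hcomp : Integrable (fun x => p₁ (impliedTarget a b xt x)) volume :=
      (h₁.comp_sub_left ((1 / a) • xt)).comp_smul (div_ne_zero hb ha)
    refine (hcomp.const_mul ((2 * Real.pi) ^ (-(d : ℝ) / 2))).mono' hmeas
      (Eventually.of_forall fun x => (hnorm x).trans ?_)
    refine mul_le_mul_of_nonneg_right (mul_le_of_le_one_right (by positivity) ?_) (hpos _)
    rw [Real.exp_le_one_iff]
    nlinarith [sq_nonneg ‖x‖]

end Gaussian

end ReverseFlow

/-! ### The three claims -/

theorem mainTheorem2 (d : ℕ) (α β : ℝ → ℝ) (t : ℝ) (hα : α t ≠ 0)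
    (lam : ℝ) (hlam : 0 < lam)
    (p₀ : EuclideanSpace ℝ (Fin d) → ℝ) (hp₀ : ReverseFlow.IsC1Density p₀)
    (Q : EuclideanSpace ℝ (Fin d) → ℝ) (hQ : ContDiff ℝ 1 Q)
    (hZ : MeasureTheory.Integrable (fun x => Real.exp (1 / lam * Q x)) MeasureTheory.volume)
    (p₁ : EuclideanSpace ℝ (Fin d) → ℝ) (hp₁ : p₁ = ReverseFlow.boltzmannDensity lam Q)
    (xt : EuclideanSpace ℝ (Fin d))
    -- the posterior at `xt` can be normalized
    (hpost : MeasureTheory.Integrable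
      (ReverseFlow.posteriorWeight p₀ p₁ (α t) (β t) xt) MeasureTheory.volume) :
    -- the control variate, at every point where `log p₀` is defined
    (∀ (Λ : Fin d → ℝ) (x₀ : EuclideanSpace ℝ (Fin d)), 0 < p₀ x₀ →
      ReverseFlow.controlVariate p₀ p₁ (α t) (β t) xt Λ x₀ =
        ReverseFlow.diagMul Λ (ReverseFlow.score p₀ x₀)
          - (1 / lam * (β t / α t)) • ReverseFlow.diagMul Λ
              (gradient Q (ReverseFlow.impliedTarget (α t) (β t) xt x₀))) ∧
    -- the posterior mean
    (∀ Λ : Fin d → ℝ,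
      MeasureTheory.Integrable (fun x₀ => x₀)
        (ReverseFlow.posterior p₀ p₁ (α t) (β t) xt) →
      MeasureTheory.Integrable (ReverseFlow.controlVariate p₀ p₁ (α t) (β t) xt Λ)
        (ReverseFlow.posterior p₀ p₁ (α t) (β t) xt) →
      MeasureTheory.Integrable
        (fun x₀ => x₀ + ReverseFlow.diagMul Λ (ReverseFlow.score p₀ x₀)
          - (1 / lam * (β t / α t)) • ReverseFlow.diagMul Λ
              (gradient Q (ReverseFlow.impliedTarget (α t) (β t) xt x₀)))
        (ReverseFlow.posterior p₀ p₁ (α t) (β t) xt) ∧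
      ReverseFlow.posteriorMean p₀ p₁ (α t) (β t) xt =
        ∫ x₀, (x₀ + ReverseFlow.diagMul Λ (ReverseFlow.score p₀ x₀)
          - (1 / lam * (β t / α t)) • ReverseFlow.diagMul Λ
              (gradient Q (ReverseFlow.impliedTarget (α t) (β t) xt x₀)))
          ∂(ReverseFlow.posterior p₀ p₁ (α t) (β t) xt)) ∧
    -- the standard Gaussian source
    (p₀ = ReverseFlow.gaussianDensity d →
      MeasureTheory.Integrable (fun x₀ => x₀)
        (ReverseFlow.posterior p₀ p₁ (α t) (β t) xt) ∧
      (MeasureTheory.Integrable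
          (ReverseFlow.controlVariate p₀ p₁ (α t) (β t) xt (fun _ => 1))
          (ReverseFlow.posterior p₀ p₁ (α t) (β t) xt) →
        MeasureTheory.Integrable (ReverseFlow.gradTerm lam Q (α t) (β t) xt)
          (ReverseFlow.posterior p₀ p₁ (α t) (β t) xt) ∧
        ReverseFlow.posteriorMean p₀ p₁ (α t) (β t) xt =
          ∫ x₀, ReverseFlow.gradTerm lam Q (α t) (β t) xt x₀
            ∂(ReverseFlow.posterior p₀ p₁ (α t) (β t) xt)) ∧
      (∀ η : ℝ,
        MeasureTheory.Integrable
          (ReverseFlow.controlVariate p₀ p₁ (α t) (β t) xt (fun _ => η))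
          (ReverseFlow.posterior p₀ p₁ (α t) (β t) xt) →
        ReverseFlow.posteriorMean p₀ p₁ (α t) (β t) xt =
          (1 - η) • (∫ x₀, x₀ ∂(ReverseFlow.posterior p₀ p₁ (α t) (β t) xt))
          + η • (∫ x₀, ReverseFlow.gradTerm lam Q (α t) (β t) xt x₀
              ∂(ReverseFlow.posterior p₀ p₁ (α t) (β t) xt)))) := by
  subst hp₁
  have hd₀ := hp₀.contDiff.differentiable one_ne_zero
  have hdQ := hQ.differentiable one_ne_zero
  have h₁ := ReverseFlow.contDiff_boltzmannDensity (lam := lam) hQ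
  have hpos := ReverseFlow.boltzmannDensity_pos hZ
  have hW := ReverseFlow.integral_posteriorWeight_pos hp₀ h₁ hpos hpost
  have hqc := ReverseFlow.contDiff_posteriorDensity (a := α t) (b := β t) (xt := xt)
    hp₀.contDiff h₁
  have hq0 := ReverseFlow.posteriorDensity_nonneg (a := α t) (b := β t) (xt := xt)
    hp₀.nonneg fun x => (hpos x).le
  have hformula : ∀ (Λ : Fin d → ℝ) (x₀ : EuclideanSpace ℝ (Fin d)), 0 < p₀ x₀ →
      ReverseFlow.controlVariate p₀ (ReverseFlow.boltzmannDensity lam Q) (α t) (β t) xt Λ x₀ =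
        ReverseFlow.diagMul Λ (ReverseFlow.score p₀ x₀)
          - (1 / lam * (β t / α t)) • ReverseFlow.diagMul Λ
              (gradient Q (ReverseFlow.impliedTarget (α t) (β t) xt x₀)) := by
    intro Λ x₀ hx
    rw [ReverseFlow.controlVariate, ReverseFlow.genSteinOp_diagonal,
      ReverseFlow.score_posteriorDensity hd₀ hdQ hZ hx hW, ReverseFlow.diagMul_sub,
      ReverseFlow.diagMul_smul]
  have hae := ReverseFlow.ae_posterior_pos (a := α t) (b := β t) (xt := xt) hp₀ h₁
  have hmean : ∀ Λ : Fin d → ℝ,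
      MeasureTheory.Integrable (fun x₀ => x₀)
        (ReverseFlow.posterior p₀ (ReverseFlow.boltzmannDensity lam Q) (α t) (β t) xt) →
      MeasureTheory.Integrable
        (ReverseFlow.controlVariate p₀ (ReverseFlow.boltzmannDensity lam Q) (α t) (β t) xt Λ)
        (ReverseFlow.posterior p₀ (ReverseFlow.boltzmannDensity lam Q) (α t) (β t) xt) →
      MeasureTheory.Integrable
        (fun x₀ => x₀ + ReverseFlow.diagMul Λ (ReverseFlow.score p₀ x₀)
          - (1 / lam * (β t / α t)) • ReverseFlow.diagMul Λ
              (gradient Q (ReverseFlow.impliedTarget (α t) (β t) xt x₀)))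
        (ReverseFlow.posterior p₀ (ReverseFlow.boltzmannDensity lam Q) (α t) (β t) xt) ∧
      ReverseFlow.posteriorMean p₀ (ReverseFlow.boltzmannDensity lam Q) (α t) (β t) xt =
        ∫ x₀, (x₀ + ReverseFlow.diagMul Λ (ReverseFlow.score p₀ x₀)
          - (1 / lam * (β t / α t)) • ReverseFlow.diagMul Λ
              (gradient Q (ReverseFlow.impliedTarget (α t) (β t) xt x₀)))
          ∂(ReverseFlow.posterior p₀ (ReverseFlow.boltzmannDensity lam Q) (α t) (β t) xt) := by
    intro Λ hx hg
    -- The formula is only available where `p₀ > 0`, which is posterior-almost everywhere.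
    have hcongr := hae.mono fun x₀ h => show
        x₀ + ReverseFlow.controlVariate p₀ (ReverseFlow.boltzmannDensity lam Q)
          (α t) (β t) xt Λ x₀ = x₀ + ReverseFlow.diagMul Λ (ReverseFlow.score p₀ x₀)
          - (1 / lam * (β t / α t)) • ReverseFlow.diagMul Λ
              (gradient Q (ReverseFlow.impliedTarget (α t) (β t) xt x₀)) by
      rw [hformula Λ x₀ h, add_sub_assoc]
    refine ⟨(hx.add hg).congr hcongr, ?_⟩
    have hstein : ∫ x₀, ReverseFlow.controlVariate p₀ (ReverseFlow.boltzmannDensity lam Q)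
        (α t) (β t) xt Λ x₀ ∂(ReverseFlow.posterior p₀ (ReverseFlow.boltzmannDensity lam Q)
          (α t) (β t) xt) = 0 :=
      ReverseFlow.integral_genSteinOp_diagonal hqc hq0 (hpost.div_const _) Λ hg
    rw [← MeasureTheory.integral_congr_ae hcongr, MeasureTheory.integral_add hx hg, hstein,
      add_zero, ReverseFlow.posteriorMean]
  refine ⟨hformula, hmean, ?_⟩
  rintro rfl
  have hx : MeasureTheory.Integrable (fun x₀ => x₀)
      (ReverseFlow.posterior (ReverseFlow.gaussianDensity d)
        (ReverseFlow.boltzmannDensity lam Q) (α t) (β t) xt) := by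
    rw [ReverseFlow.posterior, ReverseFlow.integrable_withDensity_ofReal_iff hqc.continuous hq0]
    refine ((ReverseFlow.integrable_posteriorWeight_smul_id
      (p₁ := ReverseFlow.boltzmannDensity lam Q) (b := β t) (xt := xt) hα (hZ.div_const _)
      h₁.continuous fun x => (hpos x).le).smul (∫ y, ReverseFlow.posteriorWeight (ReverseFlow.gaussianDensity d)
        (ReverseFlow.boltzmannDensity lam Q) (α t) (β t) xt y)⁻¹).congr
        (Filter.Eventually.of_forall fun x => ?_)
    simp only [Pi.smul_apply, smul_smul, ReverseFlow.posteriorDensity, div_eq_inv_mul]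
  have hgrad : MeasureTheory.Integrable
        (ReverseFlow.controlVariate (ReverseFlow.gaussianDensity d)
          (ReverseFlow.boltzmannDensity lam Q) (α t) (β t) xt (fun _ => 1))
        (ReverseFlow.posterior (ReverseFlow.gaussianDensity d)
          (ReverseFlow.boltzmannDensity lam Q) (α t) (β t) xt) →
      MeasureTheory.Integrable (ReverseFlow.gradTerm lam Q (α t) (β t) xt)
        (ReverseFlow.posterior (ReverseFlow.gaussianDensity d)
          (ReverseFlow.boltzmannDensity lam Q) (α t) (β t) xt) ∧
      ReverseFlow.posteriorMean (ReverseFlow.gaussianDensity d)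
          (ReverseFlow.boltzmannDensity lam Q) (α t) (β t) xt =
        ∫ x₀, ReverseFlow.gradTerm lam Q (α t) (β t) xt x₀
          ∂(ReverseFlow.posterior (ReverseFlow.gaussianDensity d)
            (ReverseFlow.boltzmannDensity lam Q) (α t) (β t) xt) := by
    intro hg
    have h := hmean _ hx hg
    simp only [ReverseFlow.diagMul_const, one_smul, ReverseFlow.score_gaussianDensity,
      add_neg_cancel, zero_sub] at h
    exact h
  refine ⟨hx, hgrad, fun η hη => ?_⟩
  -- For `η = 0` the gradient term may fail to be integrable, but its integral is multiplied by
  -- zero. Otherwise scaling by `η⁻¹` makes the control variate for `1` integrable, so the two means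
  -- coincide and their weights add up to one.
  rcases eq_or_ne η 0 with rfl | h0
  · simp [ReverseFlow.posteriorMean]
  · have hg := (hgrad ((hη.smul η⁻¹).congr (Filter.Eventually.of_forall fun x => by
      simp only [Pi.smul_apply, ReverseFlow.controlVariate, ReverseFlow.genSteinOp_diagonal,
        ReverseFlow.diagMul_const, smul_smul, inv_mul_cancel₀ h0]))).2
    rw [← hg, ReverseFlow.posteriorMean, ← add_smul, sub_add_cancel, one_smul]
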